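/- Let $d\ge 1$ and $\lambda>0$. Regard $\mathbb{Z}^d$ as the graph in which $u,v$ are adjacent iff $\sum_j|u_j-v_j|=1$. For a finite set $\Lambda\subset\mathbb{Z}^d$ let $Z_\Lambda=\sum_I\lambda^{|I|}$, the sum being over the independent sets $I\subset\Lambda$ of this graph. A Gibbs measure of the hard-core model with activity $\lambda$ on a countable, locally finite graph $\mathbb{G}=(V,E)$ is the law of a random set $\mathbf{I}\subset V$ such that, for every finite $\Lambda\subset V$, given $\mathbf{I}\setminus\Lambda$, the set $\mathbf{I}\cap\Lambda$ equals $I$ with probability proportional to $\lambda^{|I|}$ for every independent set $I\subset\Lambda$ that has no vertex adjacent to $\mathbf{I}\setminus\Lambda$ (and with probability $0$ for all other $I$). When there is exactly one such law, it is denoted by $\mathbb{P}_{\mathbb{G}}$; a set $S\subset\mathbb{Z}^d$ also stands for the subgraph it induces. For a set $A$ of vertices let $B_r(A)$ be the set of vertices at graph distance at most $r$ from $A$, and $\partial A$ the set of vertices of $A$ with a neighbour outside $A$; write $\sigma_v=1$ if $v\in\mathbf{I}$ and $\sigma_v=0$ otherwise. The model on $\mathbb{Z}^d$ satisfies strong spatial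 mixing (SSM) if for every finite $X\subset\mathbb{Z}^d$ and every (possibly infinite) $Y\subset\mathbb{Z}^d$ there is a function $R$ with $R(r)\to0$ as $r\to\infty$ such that for all integers $r\ge1$ $$\Big|\mathbb{P}\big(\sigma_X=s^1\,\big|\,\sigma_Y=s^2,\ \sigma_{\partial B_r(X)}=s^3\big)-\mathbb{P}\big(\sigma_X=s^1\,\big|\,\sigma_Y=s^2,\ \sigma_{\partial B_r(X)}=s^4\big)\Big|\le R(r)$$ for all spin assignments $s^1,s^2,s^3,s^4$ for which both conditions are compatible with the hard-core constraint; the conditional probabilities are those of the finite-volume Gibbs distribution on $B_r(X)\setminus(Y\cup\partial B_r(X))$ with the prescribed spins on $Y\cup\partial B_r(X)$. Let $\prec$ be the lexicographic order on $\mathbb{Z}^d$ in which the last coordinate is the most significant, and let $$\mathbb{Z}^d_{\prec0}=\{u:u\prec0\}\cup\{0\},\qquad \mathbb{Z}^d_{\prec0,\mathrm{even}}=\mathbb{Z}^d_{\prec0}\cup\Big\{u:0\prec u,\ \sum_ju_j\text{ is odd}\Big\}.$$ If the hard-core model with activity $\lambda$ on $\mathbb{Z}^d$ satisfies SSM, then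 it has a unique Gibbs measure on each of the graphs $\mathbb{Z}^d_{\prec0}$ and $\mathbb{Z}^d_{\prec0,\mathrm{even}}$; the free energy $$\mathcal{P}(d,\lambda)=\lim_{n\to\infty}\frac{\log Z_{\Lambda_n}}{|\Lambda_n|}$$ exists, and is the same, for all sequences of finite sets $0\in\Lambda_1\subset\Lambda_2\subset\cdots\subset\mathbb{Z}^d$ that eventually contain every ball around $0$ and satisfy $|\partial\Lambda_n|/|\Lambda_n|\to0$; and $$\mathcal{P}(d,\lambda)=-\log\mathbb{P}_{\mathbb{Z}^d_{\prec0}}(0\notin\mathbf{I})=-\frac12\log\mathbb{P}_{\mathbb{Z}^d_{\prec0,\mathrm{even}}}(0\notin\mathbf{I})+\frac12\log(1+\lambda).$$ -/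

import Mathlib

open Filter Topology MeasureTheory

noncomputable section

namespace HardCore

variable {V : Type*}

/-- The configuration of spins in `{0, 1}` (here `false`, `true`) has no two adjacent vertices of
spin `1`: the random set `I = {v | σ v = true}` is an independent set. -/
def IsIndependent (G : SimpleGraph V) (σ : V → Bool) : Prop :=
  ∀ u v, G.Adj u v → ¬ (σ u = true ∧ σ v = true)

open Classical in
/-- Partition function `Z_Λ` of the subgraph induced by the finite set `Λ`: the sum of `lam ^ |I|`
over the independent sets `I ⊆ Λ`. -/
def partitionFunction (G : SimpleGraph V) (lam : ℝ) (Λ : Finset V) : ℝ :=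
  ∑ I ∈ Λ.powerset.filter fun I : Finset V => G.IsIndepSet (I : Set V), lam ^ I.card

open Classical in
/-- The configuration which is the indicator of `I` on `Λ`, and is `τ` outside `Λ`. -/
def glue (Λ : Finset V) (τ : V → Bool) (I : Finset V) : V → Bool :=
  fun v => if v ∈ Λ then decide (v ∈ I) else τ v

/-- `I ⊆ Λ` is admissible given the spins `τ` outside `Λ`: it is independent, and no vertex of `I`
is adjacent to a vertex outside `Λ` of spin `1`. -/
def Admissible (G : SimpleGraph V) (Λ : Finset V) (τ : V → Bool) (I : Finset V) : Prop :=
  G.IsIndepSet (I : Set V) ∧ ∀ v ∈ I, ∀ u, u ∉ Λ → G.Adj v u → τ u = false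

open Classical in
/-- The hard-core Gibbs distribution in the finite volume `Λ`, with spins frozen to `τ` outside
`Λ`, evaluated at an event `A`. -/
def condProb (G : SimpleGraph V) (lam : ℝ) (Λ : Finset V) (τ : V → Bool)
    (A : Set (V → Bool)) : ℝ :=
  (∑ I ∈ Λ.powerset with Admissible G Λ τ I ∧ glue Λ τ I ∈ A, lam ^ I.card) /
    (∑ I ∈ Λ.powerset with Admissible G Λ τ I, lam ^ I.card)

/-- Gibbs measures of the hard-core model on a countable locally finite graph: for every finite
`Λ`, resampling the spins in `Λ` from their Gibbs distribution given the spins outside `Λ` leaves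
the measure invariant (the Dobrushin-Lanford-Ruelle equations). -/
structure IsGibbs (G : SimpleGraph V) (lam : ℝ) (μ : Measure (V → Bool)) : Prop where
  isProbabilityMeasure : IsProbabilityMeasure μ
  dlr : ∀ (Λ : Finset V) (A : Set (V → Bool)), MeasurableSet A →
    μ A = ∫⁻ τ, ENNReal.ofReal (condProb G lam Λ τ A) ∂μ

/-- `μ` is the one and only Gibbs measure of the hard-core model on `G`. -/
def IsUniqueGibbs (G : SimpleGraph V) (lam : ℝ) (μ : Measure (V → Bool)) : Prop :=
  IsGibbs G lam μ ∧ ∀ ν : Measure (V → Bool), IsGibbs G lam ν → ν = μ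

/-- `B_r(A)`, the vertices at graph distance at most `r` from `A`. -/
def ball (G : SimpleGraph V) (A : Set V) (r : ℕ) : Set V :=
  {u | ∃ v ∈ A, G.edist v u ≤ (r : ℕ∞)}

/-- `∂A`, the vertices of `A` with a neighbour outside `A`. -/
def boundary (G : SimpleGraph V) (A : Set V) : Set V :=
  {v | v ∈ A ∧ ∃ u, G.Adj v u ∧ u ∉ A}

/-- Strong spatial mixing of the hard-core model on a locally finite graph. The configurations `τ`
and `τ'` carry the spins which are fixed on `Y` (the same for both) and on `∂B_r(X)` (arbitrary);
as always, only assignments compatible with the hard-core constraint are conditioned on. The set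
`Λ` of vertices of `B_r(X)` whose spin is not fixed is finite as `G` is locally finite, and its
vertices have all their neighbours in `Λ ∪ Y ∪ ∂B_r(X)`, so that no other value of `τ` or `τ'`
matters. -/
def StrongSpatialMixing (G : SimpleGraph V) (lam : ℝ) : Prop :=
  ∀ (X : Finset V) (Y : Set V), ∃ R : ℕ → ℝ, Tendsto R atTop (𝓝 0) ∧
    ∀ r : ℕ, 1 ≤ r → ∀ Λ : Finset V,
      (Λ : Set V) = ball G X r \ (Y ∪ boundary G (ball G X r)) →
      ∀ s τ τ' : V → Bool, IsIndependent G τ → IsIndependent G τ' → (∀ v ∈ Y, τ v = τ' v) →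
        |condProb G lam Λ τ {σ | ∀ v ∈ X, σ v = s v} -
          condProb G lam Λ τ' {σ | ∀ v ∈ X, σ v = s v}| ≤ R r

/-- The lattice `ℤ^d`: `u` and `v` are adjacent when their `ℓ¹`-distance is `1`. -/
def lattice (d : ℕ) : SimpleGraph (Fin d → ℤ) where
  Adj u v := ∑ j, |u j - v j| = 1
  symm := ⟨fun u v h => by simpa only [abs_sub_comm] using h⟩
  loopless := ⟨fun u h => by simp at h⟩

/-- The lexicographic order on `ℤ^d`, in which the last coordinate is the most significant. -/
def Prec {d : ℕ} (v u : Fin d → ℤ) : Prop :=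
  ∃ k, v k < u k ∧ ∀ j, k < j → v j = u j

/-- `ℤ^d_{≺0}`: the origin and all the vertices which precede it. -/
def past (d : ℕ) : Set (Fin d → ℤ) :=
  {u | Prec u 0} ∪ {0}

/-- `ℤ^d_{≺0,even}`: the set `ℤ^d_{≺0}`, and the odd vertices which succeed the origin. -/
def pastEven (d : ℕ) : Set (Fin d → ℤ) :=
  past d ∪ {u | Odd (∑ j, u j) ∧ Prec 0 u}

/-- The origin as a vertex of `ℤ^d_{≺0}`. -/
def pastOrigin (d : ℕ) : past d := ⟨0, Or.inr rfl⟩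

/-- The origin as a vertex of `ℤ^d_{≺0,even}`. -/
def pastEvenOrigin (d : ℕ) : pastEven d := ⟨0, Or.inl (Or.inr rfl)⟩

/-- Increasing sequences of finite sets which contain the origin, contain eventually any given ball
around the origin, and whose boundary is negligible (in the sense of van Hove). -/
structure IsVanHove {d : ℕ} (Λ : ℕ → Finset (Fin d → ℤ)) : Prop where
  zero_mem : 0 ∈ Λ 0
  monotone : Monotone Λ
  exhausts : ∀ r : ℕ, ∀ᶠ n in atTop, ball (lattice d) {0} r ⊆ (Λ n : Set (Fin d → ℤ))
  boundary_small : Tendsto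
    (fun n => ((boundary (lattice d) (Λ n : Set (Fin d → ℤ))).ncard : ℝ) / ((Λ n).card : ℝ))
    atTop (𝓝 0)

/-- `P` is the free energy (pressure) of the hard-core model on `ℤ^d`: the limit of
`log Z_{Λ_n} / |Λ_n|`, the same for all van Hove sequences. -/
def IsFreeEnergy (d : ℕ) (lam P : ℝ) : Prop :=
  ∀ Λ : ℕ → Finset (Fin d → ℤ), IsVanHove Λ →
    Tendsto (fun n => Real.log (partitionFunction (lattice d) lam (Λ n)) / ((Λ n).card : ℝ))
      atTop (𝓝 P)

end HardCore

end

/-!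
Order a finite set `Λ` of sites and delete them from the largest to the smallest. Each deletion
multiplies the partition function by the probability that the deleted site is vacant, so `log Z_Λ`
is the sum over `v ∈ Λ` of `-log` of the probability that `v` is vacant in the model on the sites
of `Λ` up to `v`. Translated by `-v`, this is the model on a window of the past of the origin. If
instead only the even sites are deleted, and the odd ones are kept to the end, the remaining odd
sites are independent and contribute a factor `1 + λ` each, and `v` sees a window of
`ℤ^d_{≺0,even}`.

Strong spatial mixing passes to induced subgraphs, by freezing the complement as vacant, and makes
the vacancy probability of the origin in a window converge to its value under the unique Gibbs
measure once the window contains a large finite set. Along a van Hove sequence this fails only for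
a negligible proportion of the sites `v`, and asymptotically half of the sites are even; averaging
over `v` gives both formulas.
-/

noncomputable section

namespace HardCore

variable {V : Type*}

/-! ### Finite-volume Gibbs distributions -/

lemma glue_apply_of_mem {Λ : Finset V} {τ : V → Bool} {I : Finset V} {v : V} (hv : v ∈ Λ) :
    glue Λ τ I v = true ↔ v ∈ I := by
  simp [glue, hv]

lemma glue_apply_of_notMem {Λ : Finset V} {τ : V → Bool} {I : Finset V} {v : V} (hv : v ∉ Λ) :
    glue Λ τ I v = τ v := by
  simp [glue, hv]

lemma glue_glue (Λ : Finset V) (τ : V → Bool) (I J : Finset V) :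
    glue Λ (glue Λ τ I) J = glue Λ τ J := by
  funext v
  by_cases hv : v ∈ Λ <;> simp [glue, hv]

lemma glue_union [DecidableEq V] {Δ Λ : Finset V} (h : Δ ⊆ Λ) (τ : V → Bool) {J K : Finset V}
    (hJ : J ⊆ Λ \ Δ) (hK : K ⊆ Δ) : glue Λ τ (J ∪ K) = glue Δ (glue Λ τ J) K := by
  funext v
  rw [Bool.eq_iff_iff]
  by_cases hΔ : v ∈ Δ
  · have hvJ : v ∉ J := fun hv => (Finset.mem_sdiff.1 (hJ hv)).2 hΔ
    simp [glue_apply_of_mem hΔ, glue_apply_of_mem (h hΔ), hvJ]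
  · have hvK : v ∉ K := fun hv => hΔ (hK hv)
    rw [glue_apply_of_notMem hΔ]
    by_cases hΛ : v ∈ Λ
    · simp [glue_apply_of_mem hΛ, hvK]
    · simp [glue_apply_of_notMem hΛ]

lemma admissible_empty (G : SimpleGraph V) (Λ : Finset V) (τ : V → Bool) :
    Admissible G Λ τ ∅ := by
  simp [Admissible]

lemma Admissible.not_glue_and_glue {G : SimpleGraph V} {Λ : Finset V} {τ : V → Bool}
    {I : Finset V} (h : Admissible G Λ τ I) {u v : V} (huv : G.Adj u v) (hu : u ∈ Λ) :
    ¬ (glue Λ τ I u = true ∧ glue Λ τ I v = true) := by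
  rintro ⟨hgu, hgv⟩
  rw [glue_apply_of_mem hu] at hgu
  by_cases hv : v ∈ Λ
  · exact h.1 hgu ((glue_apply_of_mem hv).1 hgv) huv.ne huv
  · simp [glue_apply_of_notMem hv, h.2 u hgu v hv huv] at hgv

lemma isIndependent_false (G : SimpleGraph V) : IsIndependent G fun _ => false := by
  simp [IsIndependent]

lemma Admissible.isIndependent_glue {G : SimpleGraph V} {Λ : Finset V} {τ : V → Bool}
    {I : Finset V} (h : Admissible G Λ τ I) (hτ : IsIndependent G τ) :
    IsIndependent G (glue Λ τ I) := by
  intro u v huv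
  by_cases hu : u ∈ Λ
  · exact h.not_glue_and_glue huv hu
  by_cases hv : v ∈ Λ
  · exact fun hg => h.not_glue_and_glue huv.symm hv hg.symm
  · simpa only [glue_apply_of_notMem hu, glue_apply_of_notMem hv] using hτ u v huv

lemma isIndepSet_union [DecidableEq V] (G : SimpleGraph V) (J K : Finset V) :
    G.IsIndepSet ((J ∪ K : Finset V) : Set V) ↔
      G.IsIndepSet (J : Set V) ∧ G.IsIndepSet (K : Set V) ∧
        ∀ v ∈ K, ∀ u ∈ J, ¬ G.Adj v u := by
  simp only [SimpleGraph.isIndepSet_iff, Finset.coe_union, Set.pairwise_union, Finset.mem_coe]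
  refine and_congr_right fun _ => and_congr_right fun _ => ⟨fun h v hv u hu huv => ?_, ?_⟩
  · exact (h u hu v hv huv.ne').2 huv
  · exact fun h u hu v hv _ => ⟨fun huv => h v hv u hu huv.symm, h v hv u hu⟩

lemma admissible_union [DecidableEq V] (G : SimpleGraph V) {Δ Λ : Finset V} (h : Δ ⊆ Λ)
    (τ : V → Bool) {J K : Finset V} (hJ : J ⊆ Λ \ Δ) :
    Admissible G Λ τ (J ∪ K) ↔ Admissible G Λ τ J ∧ Admissible G Δ (glue Λ τ J) K := by
  have hglue : (∀ v ∈ K, ∀ u ∉ Δ, G.Adj v u → glue Λ τ J u = false) ↔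
      (∀ v ∈ K, ∀ u ∈ J, ¬ G.Adj v u) ∧ ∀ v ∈ K, ∀ u ∉ Λ, G.Adj v u → τ u = false := by
    constructor
    · refine fun hK => ⟨fun v hv u hu huv => ?_, fun v hv u hu huv => ?_⟩
      · obtain ⟨huΛ, huΔ⟩ := Finset.mem_sdiff.1 (hJ hu)
        exact Bool.eq_false_iff.1 (hK v hv u huΔ huv) ((glue_apply_of_mem huΛ).2 hu)
      · rw [← glue_apply_of_notMem (τ := τ) (I := J) hu]
        exact hK v hv u (fun huΔ => hu (h huΔ)) huv
    · rintro ⟨hKJ, hKτ⟩ v hv u - huv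
      by_cases hu : u ∈ Λ
      · rw [Bool.eq_false_iff, Ne, glue_apply_of_mem hu]
        exact fun huJ => hKJ v hv u huJ huv
      · rw [glue_apply_of_notMem hu]
        exact hKτ v hv u hu huv
  simp only [Admissible, isIndepSet_union, hglue, Finset.forall_mem_union]
  tauto

open Classical in
/-- The unnormalized Gibbs weight of `I ⊆ Λ` given the spins `τ` outside `Λ`. -/
def weight (G : SimpleGraph V) (lam : ℝ) (Λ : Finset V) (τ : V → Bool) (I : Finset V) : ℝ :=
  if Admissible G Λ τ I then lam ^ I.card else 0

/-- The unnormalized Gibbs expectation of `f` in the volume `Λ`, given the spins `τ` outside `Λ`;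
its value at `f = 1` is the partition function with boundary condition `τ`. -/
def gibbsSum (G : SimpleGraph V) (lam : ℝ) (Λ : Finset V) (τ : V → Bool)
    (f : (V → Bool) → ℝ) : ℝ :=
  ∑ I ∈ Λ.powerset, weight G lam Λ τ I * f (glue Λ τ I)

section Weights

variable (G : SimpleGraph V) {lam : ℝ} (Λ : Finset V) (τ : V → Bool)

lemma weight_nonneg (hlam : 0 ≤ lam) (I : Finset V) : 0 ≤ weight G lam Λ τ I := by
  unfold weight
  split_ifs <;> positivity

lemma weight_union [DecidableEq V] {Δ Λ : Finset V} (h : Δ ⊆ Λ) (τ : V → Bool)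
    {J K : Finset V} (hJ : J ⊆ Λ \ Δ) (hK : K ⊆ Δ) :
    weight G lam Λ τ (J ∪ K) = weight G lam Λ τ J * weight G lam Δ (glue Λ τ J) K := by
  classical
  have hcard : (J ∪ K).card = J.card + K.card :=
    Finset.card_union_of_disjoint (Finset.disjoint_of_subset_left hJ
      (Finset.disjoint_of_subset_right hK Finset.sdiff_disjoint))
  simp only [weight, hcard, pow_add, ite_zero_mul_ite_zero]
  exact if_congr (admissible_union G h τ hJ) rfl rfl

lemma gibbsSum_mono (hlam : 0 ≤ lam) {f g : (V → Bool) → ℝ} (hfg : f ≤ g) :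
    gibbsSum G lam Λ τ f ≤ gibbsSum G lam Λ τ g :=
  Finset.sum_le_sum fun _ _ => mul_le_mul_of_nonneg_left (hfg _) (weight_nonneg G Λ τ hlam _)

lemma gibbsSum_nonneg (hlam : 0 ≤ lam) {f : (V → Bool) → ℝ} (hf : 0 ≤ f) :
    0 ≤ gibbsSum G lam Λ τ f :=
  Finset.sum_nonneg fun _ _ => mul_nonneg (weight_nonneg G Λ τ hlam _) (hf _)

lemma gibbsSum_one_pos (hlam : 0 ≤ lam) : 0 < gibbsSum G lam Λ τ 1 :=
  Finset.sum_pos' (fun _ _ => by simpa using weight_nonneg G Λ τ hlam _)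
    ⟨∅, Finset.empty_mem_powerset _, by simp [weight, admissible_empty]⟩

lemma sum_powerset_eq_sum_sdiff {M : Type*} [AddCommMonoid M] [DecidableEq V] {Δ Λ : Finset V}
    (h : Δ ⊆ Λ) (f : Finset V → M) :
    ∑ I ∈ Λ.powerset, f I = ∑ J ∈ (Λ \ Δ).powerset, ∑ K ∈ Δ.powerset, f (J ∪ K) := by
  rw [← Finset.sum_product']
  refine Finset.sum_nbij' (fun I => (I \ Δ, I ∩ Δ)) (fun p => p.1 ∪ p.2) ?_ ?_ ?_ ?_ ?_ <;>
    simp only [Finset.mem_product, Finset.mem_powerset, Prod.forall, Prod.mk.injEq, and_imp]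
  · exact fun I hI => ⟨Finset.sdiff_subset_sdiff hI le_rfl, Finset.inter_subset_right⟩
  · exact fun J K hJ hK => Finset.union_subset (hJ.trans Finset.sdiff_subset) (hK.trans h)
  · exact fun I _ => Finset.sdiff_union_inter I Δ
  · refine fun J K hJ hK => ?_
    have hJΔ : Disjoint J Δ := Finset.disjoint_of_subset_left hJ Finset.sdiff_disjoint
    rw [Finset.union_sdiff_distrib, Finset.union_inter_distrib_right, hJΔ.sdiff_eq_left,
      Finset.sdiff_eq_empty_iff_subset.2 hK, Finset.disjoint_iff_inter_eq_empty.1 hJΔ,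
      Finset.inter_eq_left.2 hK, Finset.union_empty, Finset.empty_union]
    exact ⟨rfl, rfl⟩
  · exact fun I _ => by rw [Finset.sdiff_union_inter]

lemma gibbsSum_eq_sum_sdiff [DecidableEq V] {Δ Λ : Finset V} (h : Δ ⊆ Λ) (τ : V → Bool)
    (f : (V → Bool) → ℝ) :
    gibbsSum G lam Λ τ f =
      ∑ J ∈ (Λ \ Δ).powerset, weight G lam Λ τ J * gibbsSum G lam Δ (glue Λ τ J) f := by
  simp only [gibbsSum, sum_powerset_eq_sum_sdiff h, Finset.mul_sum]
  refine Finset.sum_congr rfl fun J hJ => Finset.sum_congr rfl fun K hK => ?_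
  rw [Finset.mem_powerset] at hJ hK
  rw [weight_union G h τ hJ hK, glue_union h τ hJ hK, mul_assoc]

lemma condProb_eq_div (A : Set (V → Bool)) :
    condProb G lam Λ τ A = gibbsSum G lam Λ τ (A.indicator 1) / gibbsSum G lam Λ τ 1 := by
  classical
  simp [condProb, gibbsSum, weight, Finset.sum_filter, Set.indicator_apply, ← ite_and,
    and_comm]

lemma condProb_nonneg (hlam : 0 ≤ lam) (A : Set (V → Bool)) : 0 ≤ condProb G lam Λ τ A := by
  rw [condProb_eq_div]
  exact div_nonneg (gibbsSum_nonneg G Λ τ hlam (Set.indicator_nonneg fun _ _ => zero_le_one))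
    (gibbsSum_one_pos G Λ τ hlam).le

lemma condProb_le_one (hlam : 0 ≤ lam) (A : Set (V → Bool)) : condProb G lam Λ τ A ≤ 1 := by
  rw [condProb_eq_div]
  exact div_le_one_of_le₀
    (gibbsSum_mono G Λ τ hlam (Set.indicator_le_self' fun _ _ => zero_le_one))
    (gibbsSum_one_pos G Λ τ hlam).le

lemma condProb_eq_zero {A : Set (V → Bool)} (h : ∀ I, Admissible G Λ τ I → glue Λ τ I ∉ A) :
    condProb G lam Λ τ A = 0 := by
  classical
  rw [condProb, Finset.filter_false_of_mem fun I _ hI => h I hI.1 hI.2, Finset.sum_empty,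
    zero_div]

lemma weight_glue (K I : Finset V) : weight G lam Λ (glue Λ τ K) I = weight G lam Λ τ I := by
  classical
  have hadm : Admissible G Λ (glue Λ τ K) I ↔ Admissible G Λ τ I :=
    and_congr_right fun _ => forall₂_congr fun _ _ => forall₃_congr fun _ hu _ => by
      rw [glue_apply_of_notMem hu]
  exact if_congr hadm rfl rfl

lemma condProb_glue (K : Finset V) (A : Set (V → Bool)) :
    condProb G lam Λ (glue Λ τ K) A = condProb G lam Λ τ A := by
  simp only [condProb_eq_div, gibbsSum, weight_glue, glue_glue, Pi.one_apply]

lemma gibbsSum_condProb (hlam : 0 ≤ lam) {Δ Λ : Finset V} (h : Δ ⊆ Λ) (τ : V → Bool)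
    (A : Set (V → Bool)) :
    gibbsSum G lam Λ τ (condProb G lam Δ · A) = gibbsSum G lam Λ τ (A.indicator 1) := by
  classical
  rw [gibbsSum_eq_sum_sdiff G h, gibbsSum_eq_sum_sdiff G h]
  refine Finset.sum_congr rfl fun J _ => congrArg _ ?_
  have hconst : gibbsSum G lam Δ (glue Λ τ J) (condProb G lam Δ · A) =
      gibbsSum G lam Δ (glue Λ τ J) 1 * condProb G lam Δ (glue Λ τ J) A := by
    simp only [gibbsSum, condProb_glue, Pi.one_apply, mul_one, Finset.sum_mul]
  rw [hconst, condProb_eq_div, mul_div_cancel₀ _ (gibbsSum_one_pos G Δ _ hlam).ne']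

end Weights

/-- The finite-volume Gibbs distribution in `Λ` with spins frozen to `τ` outside `Λ`, as a measure
on configurations. -/
def gibbsMeasure (G : SimpleGraph V) (lam : ℝ) (Λ : Finset V) (τ : V → Bool) :
    Measure (V → Bool) :=
  ∑ I ∈ Λ.powerset, ENNReal.ofReal (weight G lam Λ τ I / gibbsSum G lam Λ τ 1) •
    Measure.dirac (glue Λ τ I)

section GibbsMeasure

variable (G : SimpleGraph V) {lam : ℝ} (Λ : Finset V) (τ : V → Bool)

lemma lintegral_gibbsMeasure (hlam : 0 ≤ lam) {f : (V → Bool) → ℝ} (hf : Measurable f)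
    (hf₀ : 0 ≤ f) :
    ∫⁻ σ, ENNReal.ofReal (f σ) ∂gibbsMeasure G lam Λ τ =
      ENNReal.ofReal (gibbsSum G lam Λ τ f / gibbsSum G lam Λ τ 1) := by
  have hprob (I : Finset V) : 0 ≤ weight G lam Λ τ I / gibbsSum G lam Λ τ 1 :=
    div_nonneg (weight_nonneg G Λ τ hlam I) (gibbsSum_one_pos G Λ τ hlam).le
  have hsum : gibbsSum G lam Λ τ f / gibbsSum G lam Λ τ 1 =
      ∑ I ∈ Λ.powerset, weight G lam Λ τ I / gibbsSum G lam Λ τ 1 * f (glue Λ τ I) := by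
    simp only [gibbsSum, Finset.sum_div, div_mul_eq_mul_div]
  rw [hsum, ENNReal.ofReal_sum_of_nonneg fun I _ => mul_nonneg (hprob I) (hf₀ _), gibbsMeasure,
    lintegral_finsetSum_measure]
  refine Finset.sum_congr rfl fun I _ => ?_
  rw [lintegral_smul_measure, lintegral_dirac' _ hf.ennreal_ofReal, smul_eq_mul,
    ENNReal.ofReal_mul (hprob I)]

lemma gibbsMeasure_apply (hlam : 0 ≤ lam) {A : Set (V → Bool)} (hA : MeasurableSet A) :
    gibbsMeasure G lam Λ τ A = ENNReal.ofReal (condProb G lam Λ τ A) := by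
  rw [condProb_eq_div, ← lintegral_gibbsMeasure G Λ τ hlam (measurable_one.indicator hA)
    (Set.indicator_nonneg fun _ _ => zero_le_one), ← lintegral_indicator_one hA]
  refine lintegral_congr fun σ => ?_
  by_cases hσ : σ ∈ A <;> simp [hσ]

lemma isProbabilityMeasure_gibbsMeasure (hlam : 0 ≤ lam) :
    IsProbabilityMeasure (gibbsMeasure G lam Λ τ) where
  measure_univ := by
    rw [gibbsMeasure_apply G Λ τ hlam .univ, condProb_eq_div, Set.indicator_univ,
      div_self (gibbsSum_one_pos G Λ τ hlam).ne', ENNReal.ofReal_one]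

lemma measurable_glue (I : Finset V) : Measurable fun τ : V → Bool => glue Λ τ I := by
  refine measurable_pi_lambda _ fun v => ?_
  by_cases hv : v ∈ Λ
  · simp only [glue, hv, if_true, measurable_const]
  · simpa only [glue, hv, if_false] using measurable_pi_apply v

lemma measurableSet_spin (v : V) (b : Bool) : MeasurableSet {σ : V → Bool | σ v = b} :=
  measurableSet_eq_fun (measurable_pi_apply v) measurable_const

lemma measurableSet_pair (u v : V) :
    MeasurableSet {σ : V → Bool | σ u = true ∧ σ v = true} :=
  (measurableSet_spin u true).inter (measurableSet_spin v true)

lemma measurableSet_admissible [Countable V] (I : Finset V) :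
    MeasurableSet {τ : V → Bool | Admissible G Λ τ I} := by
  simp only [Admissible, Set.ofPred_and, Set.ofPred_forall]
  exact (MeasurableSet.const _).inter (Finset.measurableSet_biInter _ fun v _ =>
    .iInter fun u => .iInter fun _ => .iInter fun _ => measurableSet_spin u false)

lemma measurable_gibbsSum [Countable V] {f : (V → Bool) → ℝ} (hf : Measurable f) :
    Measurable fun τ => gibbsSum G lam Λ τ f :=
  Finset.measurable_sum _ fun I _ =>
    (Measurable.ite (measurableSet_admissible G Λ I) measurable_const measurable_const).mul
      (hf.comp (measurable_glue Λ I))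

lemma measurable_condProb [Countable V] {A : Set (V → Bool)} (hA : MeasurableSet A) :
    Measurable fun τ => condProb G lam Λ τ A := by
  simp only [condProb_eq_div]
  exact (measurable_gibbsSum G Λ (measurable_one.indicator hA)).div
    (measurable_gibbsSum G Λ measurable_one)

lemma measurable_gibbsMeasure [Countable V] (hlam : 0 ≤ lam) :
    Measurable (gibbsMeasure G lam Λ) :=
  Measure.measurable_of_measurable_coe _ fun A hA => by
    simpa only [gibbsMeasure_apply G Λ _ hlam hA]
      using (measurable_condProb G Λ hA).ennreal_ofReal

lemma gibbsMeasure_bind [Countable V] (hlam : 0 ≤ lam) {Δ Λ : Finset V} (h : Δ ⊆ Λ)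
    (τ : V → Bool) :
    (gibbsMeasure G lam Λ τ).bind (gibbsMeasure G lam Δ) = gibbsMeasure G lam Λ τ := by
  ext A hA
  simp only [Measure.bind_apply hA (measurable_gibbsMeasure G Δ hlam).aemeasurable,
    gibbsMeasure_apply G _ _ hlam hA]
  rw [lintegral_gibbsMeasure G Λ τ hlam (measurable_condProb G Δ hA)
    fun σ => condProb_nonneg G Δ σ hlam A, gibbsSum_condProb G hlam h, condProb_eq_div]

end GibbsMeasure

section Dlr

variable [Countable V] {G : SimpleGraph V} {lam : ℝ}

lemma isGibbs_iff_bind_eq (hlam : 0 ≤ lam) {μ : Measure (V → Bool)} :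
    IsGibbs G lam μ ↔
      IsProbabilityMeasure μ ∧ ∀ Λ : Finset V, μ.bind (gibbsMeasure G lam Λ) = μ := by
  have hbind (Λ : Finset V) {A : Set (V → Bool)} (hA : MeasurableSet A) :
      μ.bind (gibbsMeasure G lam Λ) A = ∫⁻ τ, ENNReal.ofReal (condProb G lam Λ τ A) ∂μ := by
    simp only [Measure.bind_apply hA (measurable_gibbsMeasure G Λ hlam).aemeasurable,
      gibbsMeasure_apply G Λ _ hlam hA]
  constructor
  · exact fun h => ⟨h.isProbabilityMeasure, fun Λ => Measure.ext fun A hA =>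
      (hbind Λ hA).trans (h.dlr Λ A hA).symm⟩
  · exact fun ⟨hp, h⟩ => ⟨hp, fun Λ A hA => by rw [← hbind Λ hA, h Λ]⟩

lemma integrable_condProb (hlam : 0 ≤ lam) (Λ : Finset V) (μ : Measure (V → Bool))
    [IsFiniteMeasure μ] {A : Set (V → Bool)} (hA : MeasurableSet A) :
    Integrable (fun τ => condProb G lam Λ τ A) μ :=
  .of_bound (measurable_condProb G Λ hA).aestronglyMeasurable 1 <| .of_forall fun τ => by
    rw [Real.norm_of_nonneg (condProb_nonneg G Λ τ hlam A)]
    exact condProb_le_one G Λ τ hlam A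

lemma measureReal_bind_gibbsMeasure (hlam : 0 ≤ lam) (Λ : Finset V) (μ : Measure (V → Bool))
    {A : Set (V → Bool)} (hA : MeasurableSet A) :
    (μ.bind (gibbsMeasure G lam Λ)).real A = ∫ τ, condProb G lam Λ τ A ∂μ := by
  simp only [measureReal_def, gibbsMeasure_apply G Λ _ hlam hA,
    Measure.bind_apply hA (measurable_gibbsMeasure G Λ hlam).aemeasurable]
  rw [integral_eq_lintegral_of_nonneg_ae (.of_forall fun τ => condProb_nonneg G Λ τ hlam A)
    (measurable_condProb G Λ hA).aestronglyMeasurable]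

lemma ae_isIndependent_of_forall_adj {μ : Measure (V → Bool)}
    (h : ∀ u v, G.Adj u v → μ {σ | σ u = true ∧ σ v = true} = 0) :
    ∀ᵐ σ ∂μ, IsIndependent G σ := by
  simp only [IsIndependent, ae_all_iff]
  exact fun u v huv => by simpa only [ae_iff, not_not] using h u v huv

lemma ae_isIndependent_gibbsMeasure (hlam : 0 ≤ lam) (Λ : Finset V) {τ : V → Bool}
    (hτ : IsIndependent G τ) : ∀ᵐ σ ∂gibbsMeasure G lam Λ τ, IsIndependent G σ :=
  ae_isIndependent_of_forall_adj fun u v huv => by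
    rw [gibbsMeasure_apply G Λ τ hlam (measurableSet_pair u v),
      condProb_eq_zero G Λ τ fun I hI => hI.isIndependent_glue hτ u v huv, ENNReal.ofReal_zero]

lemma IsGibbs.ae_isIndependent {μ : Measure (V → Bool)} (hμ : IsGibbs G lam μ) :
    ∀ᵐ σ ∂μ, IsIndependent G σ :=
  ae_isIndependent_of_forall_adj fun u v huv => by
    have hzero (τ : V → Bool) :
        condProb G lam {u} τ {σ | σ u = true ∧ σ v = true} = 0 :=
      condProb_eq_zero G {u} τ fun I hI => hI.not_glue_and_glue huv (Finset.mem_singleton_self u)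
    simp only [hμ.dlr {u} _ (measurableSet_pair u v), hzero, ENNReal.ofReal_zero,
      lintegral_zero]

end Dlr

/-! ### Cylinder events -/

/-- The event that the spins on `X` are those of `s`. -/
def cylinder (X : Finset V) (s : V → Bool) : Set (V → Bool) := {σ | ∀ v ∈ X, σ v = s v}

lemma cylinder_eq_preimage (X : Finset V) (s : V → Bool) :
    cylinder X s = X.restrict (π := fun _ => Bool) ⁻¹' {X.restrict s} := by
  ext σ
  simp [cylinder, funext_iff]

lemma cylinder_singleton (v : V) (s : V → Bool) : cylinder {v} s = {σ | σ v = s v} := by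
  simp [cylinder]

lemma measurableSet_cylinder (X : Finset V) (s : V → Bool) : MeasurableSet (cylinder X s) := by
  rw [cylinder_eq_preimage]
  exact X.measurable_restrict (measurableSet_singleton _)

lemma isClopen_cylinder (X : Finset V) (s : V → Bool) : IsClopen (cylinder X s) := by
  rw [cylinder_eq_preimage]
  exact (isClopen_discrete _).preimage (X.continuous_restrict)

lemma ext_of_measureReal_cylinder {μ ν : Measure (V → Bool)} [IsFiniteMeasure μ]
    [IsFiniteMeasure ν] (h : ∀ X s, μ.real (cylinder X s) = ν.real (cylinder X s)) : μ = ν := by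
  refine IsProjectiveLimit.unique (P := fun X : Finset V => ν.map X.restrict)
    (fun X => Measure.ext_of_singleton fun ρ => ?_) fun X => rfl
  obtain ⟨s, hs⟩ : ∃ s : V → Bool, X.restrict s = ρ :=
    (Subtype.val_injective (p := (· ∈ X))).surjective_comp_right ρ
  rw [Measure.map_apply X.measurable_restrict (measurableSet_singleton _),
    Measure.map_apply X.measurable_restrict (measurableSet_singleton _), ← hs,
    ← cylinder_eq_preimage, ← measureReal_eq_measureReal_iff]
  exact h X s

/-! ### Existence of Gibbs measures -/

section Existence

variable {G : SimpleGraph V} (hG : ∀ v, (G.neighborSet v).Finite) {lam : ℝ} (Λ : Finset V)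

lemma continuous_glue (I : Finset V) : Continuous fun τ : V → Bool => glue Λ τ I := by
  refine continuous_pi fun v => ?_
  by_cases hv : v ∈ Λ
  · simp only [glue, hv, if_true, continuous_const]
  · simpa only [glue, hv, if_false] using continuous_apply v

include hG

lemma isClopen_admissible (I : Finset V) : IsClopen {τ : V → Bool | Admissible G Λ τ I} := by
  have heq : {τ : V → Bool | Admissible G Λ τ I} = {_τ | G.IsIndepSet (I : Set V)} ∩
      ⋂ v ∈ I, ⋂ u ∈ G.neighborSet v \ Λ, {τ | τ u = false} := by
    ext τ
    simp only [Admissible, Set.mem_ofPred_eq, Set.mem_inter_iff, Set.mem_iInter, Set.mem_sdiff,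
      Finset.mem_coe, SimpleGraph.mem_neighborSet, and_imp]
    exact and_congr_right fun _ => forall₂_congr fun _ _ => forall_congr' fun _ => imp.swap
  rw [heq]
  exact IsClopen.inter ⟨isClosed_const, isOpen_const⟩ (isClopen_biInter_finset fun v _ =>
    ((hG v).subset Set.sdiff_subset).isClopen_biInter fun u _ =>
      (isClopen_discrete {false}).preimage (continuous_apply u))

lemma continuous_gibbsSum {f : (V → Bool) → ℝ} (hf : Continuous f) :
    Continuous fun τ => gibbsSum G lam Λ τ f :=
  continuous_finsetSum _ fun I _ =>
    ((isClopen_admissible hG Λ I).continuous_indicator continuous_const).mul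
      (hf.comp (continuous_glue Λ I))

lemma continuous_condProb (hlam : 0 ≤ lam) {A : Set (V → Bool)} (hA : IsClopen A) :
    Continuous fun τ => condProb G lam Λ τ A := by
  simp only [condProb_eq_div]
  exact (continuous_gibbsSum hG Λ (hA.continuous_indicator continuous_one)).div
    (continuous_gibbsSum hG Λ continuous_one) fun τ => (gibbsSum_one_pos G Λ τ hlam).ne'

lemma isGibbs_of_tendsto [Countable V] (hlam : 0 ≤ lam) {l : Filter (Finset V)} [l.NeBot]
    (hl : l ≤ atTop) {τ : Finset V → V → Bool} {F : Finset V → ProbabilityMeasure (V → Bool)}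
    (hF : ∀ Λ, (F Λ : Measure (V → Bool)) = gibbsMeasure G lam Λ (τ Λ))
    {μ : ProbabilityMeasure (V → Bool)} (hμ : Tendsto F l (𝓝 μ)) : IsGibbs G lam μ := by
  refine (isGibbs_iff_bind_eq hlam).2 ⟨inferInstance, fun Δ => ?_⟩
  have hprob (τ : V → Bool) := isProbabilityMeasure_gibbsMeasure G Δ τ hlam
  have hbind : IsProbabilityMeasure ((μ : Measure (V → Bool)).bind (gibbsMeasure G lam Δ)) :=
    isProbabilityMeasure_bind (measurable_gibbsMeasure G Δ hlam).aemeasurable (.of_forall hprob)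
  refine ext_of_measureReal_cylinder fun X s => ?_
  have hX := measurableSet_cylinder X s
  rw [measureReal_bind_gibbsMeasure hlam Δ _ hX]
  refine tendsto_nhds_unique (ProbabilityMeasure.tendsto_iff_forall_integral_tendsto.1 hμ
    (.mkOfCompact ⟨_, continuous_condProb hG Δ hlam (isClopen_cylinder X s)⟩)) ?_
  refine (NNReal.tendsto_coe.2 (ProbabilityMeasure.tendsto_measure_of_isClopen_of_tendsto hμ
    (isClopen_cylinder X s))).congr' ?_
  filter_upwards [hl (eventually_ge_atTop Δ)] with Λ hΛ
  calc ((F Λ : Measure (V → Bool))).real (cylinder X s)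
      = ((F Λ : Measure (V → Bool)).bind (gibbsMeasure G lam Δ)).real (cylinder X s) := by
        rw [hF Λ, gibbsMeasure_bind G hlam hΛ]
    _ = ∫ σ, condProb G lam Δ σ (cylinder X s) ∂(F Λ) :=
        measureReal_bind_gibbsMeasure hlam Δ _ hX

lemma exists_isGibbs [Countable V] (hlam : 0 ≤ lam) :
    ∃ μ : Measure (V → Bool), IsGibbs G lam μ := by
  let F (Λ : Finset V) : ProbabilityMeasure (V → Bool) :=
    ⟨gibbsMeasure G lam Λ fun _ => false, isProbabilityMeasure_gibbsMeasure G Λ _ hlam⟩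
  let U : Ultrafilter (Finset V) := .of atTop
  exact ⟨(U.map F).lim, isGibbs_of_tendsto hG hlam (Ultrafilter.of_le atTop) (fun Λ => rfl)
    (U.map F).le_nhds_lim⟩

end Existence

/-! ### Spatial mixing -/

/-- The influence of the spins outside a large volume on any finite set of spins is uniformly
small: the part of strong spatial mixing needed for uniqueness of the Gibbs measure, in which no
further spins are frozen. -/
def SpatialMixing (G : SimpleGraph V) (lam : ℝ) : Prop :=
  ∀ (X : Finset V) (s : V → Bool) (ε : ℝ), 0 < ε → ∃ Λ : Finset V,
    ∀ τ τ' : V → Bool, IsIndependent G τ → IsIndependent G τ' →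
      |condProb G lam Λ τ (cylinder X s) - condProb G lam Λ τ' (cylinder X s)| ≤ ε

section SpatialMixing

variable [Countable V] {G : SimpleGraph V} {lam : ℝ}

lemma abs_measureReal_sub_le_of_bind_eq (hlam : 0 ≤ lam) {Λ : Finset V}
    {μ : Measure (V → Bool)} [IsProbabilityMeasure μ] (hμ : μ.bind (gibbsMeasure G lam Λ) = μ)
    (hind : ∀ᵐ σ ∂μ, IsIndependent G σ) {A : Set (V → Bool)} (hA : MeasurableSet A) {c ε : ℝ}
    (h : ∀ τ, IsIndependent G τ → |condProb G lam Λ τ A - c| ≤ ε) : |μ.real A - c| ≤ ε := by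
  have hmean : μ.real A - c = ∫ τ, (condProb G lam Λ τ A - c) ∂μ := by
    rw [integral_sub (integrable_condProb hlam Λ μ hA) (integrable_const c),
      ← measureReal_bind_gibbsMeasure hlam Λ μ hA, hμ, integral_const, probReal_univ, one_smul]
  rw [hmean, ← Real.norm_eq_abs]
  exact (norm_integral_le_of_norm_le_const (C := ε) (hind.mono h)).trans_eq (by simp)

lemma SpatialMixing.tendsto_condProb (h : SpatialMixing G lam) (hlam : 0 ≤ lam)
    {μ : Measure (V → Bool)} (hμ : IsGibbs G lam μ) (X : Finset V) (s : V → Bool) :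
    Tendsto (fun Λ : Finset V => condProb G lam Λ (fun _ => false) (cylinder X s)) atTop
      (𝓝 (μ.real (cylinder X s))) := by
  have hX := measurableSet_cylinder X s
  refine Metric.tendsto_nhds.2 fun ε hε => ?_
  obtain ⟨Δ, hΔ⟩ := h X s (ε / 3) (by positivity)
  filter_upwards [eventually_ge_atTop Δ] with Λ hΛ
  have hclose (τ : V → Bool) (hτ : IsIndependent G τ) := hΔ τ _ hτ (isIndependent_false G)
  have := hμ.isProbabilityMeasure
  have := isProbabilityMeasure_gibbsMeasure G Λ (fun _ => false) hlam
  have hdist_μ := abs_measureReal_sub_le_of_bind_eq hlam (((isGibbs_iff_bind_eq hlam).1 hμ).2 Δ)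
    hμ.ae_isIndependent hX hclose
  have hdist_Λ := abs_measureReal_sub_le_of_bind_eq hlam (gibbsMeasure_bind G hlam hΛ _)
    (ae_isIndependent_gibbsMeasure hlam Λ (isIndependent_false G)) hX hclose
  rw [measureReal_def, gibbsMeasure_apply G Λ _ hlam hX,
    ENNReal.toReal_ofReal (condProb_nonneg G Λ _ hlam _)] at hdist_Λ
  calc dist (condProb G lam Λ (fun _ => false) (cylinder X s)) (μ.real (cylinder X s))
      ≤ ε / 3 + ε / 3 := dist_triangle_right _ _ (condProb G lam Δ (fun _ => false) _) |>.trans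
        (add_le_add hdist_Λ hdist_μ)
    _ < ε := by linarith

lemma SpatialMixing.isUniqueGibbs (h : SpatialMixing G lam) (hlam : 0 ≤ lam)
    {μ : Measure (V → Bool)} (hμ : IsGibbs G lam μ) : IsUniqueGibbs G lam μ := by
  refine ⟨hμ, fun ν hν => ?_⟩
  have := hμ.isProbabilityMeasure
  have := hν.isProbabilityMeasure
  exact ext_of_measureReal_cylinder fun X s =>
    tendsto_nhds_unique (h.tendsto_condProb hlam hν X s) (h.tendsto_condProb hlam hμ X s)

end SpatialMixing

/-! ### Subgraphs -/

section Embedding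

variable {W : Type*} {G : SimpleGraph V} {H : SimpleGraph W} {lam : ℝ} (e : H ↪g G)

lemma sum_powerset_map {M : Type*} [AddCommMonoid M] (e : W ↪ V) (Λ : Finset W)
    (f : Finset V → M) :
    ∑ J ∈ (Λ.map e).powerset, f J = ∑ I ∈ Λ.powerset, f (I.map e) := by
  classical
  rw [Finset.map_eq_image, Finset.powerset_image, Finset.sum_image]
  · simp only [Finset.map_eq_image]
  · exact fun I _ J _ h => Finset.image_injective e.injective h

lemma glue_map_comp (Λ I : Finset W) (τ : V → Bool) :
    glue (Λ.map e.toEmbedding) τ (I.map e.toEmbedding) ∘ e = glue Λ (τ ∘ e) I := by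
  funext w
  have hmem (S : Finset W) : e w ∈ S.map e.toEmbedding ↔ w ∈ S := Finset.mem_map' e.toEmbedding
  by_cases hw : w ∈ Λ
  · rw [Function.comp_apply, Bool.eq_iff_iff, glue_apply_of_mem ((hmem Λ).2 hw),
      glue_apply_of_mem hw, hmem]
  · rw [Function.comp_apply, glue_apply_of_notMem ((hmem Λ).not.2 hw), glue_apply_of_notMem hw]
    rfl

lemma isIndepSet_map (I : Finset W) :
    G.IsIndepSet (I.map e.toEmbedding : Set V) ↔ H.IsIndepSet (I : Set W) := by
  rw [SimpleGraph.isIndepSet_iff, SimpleGraph.isIndepSet_iff, Finset.coe_map,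
    e.toEmbedding.injective.injOn.pairwise_image]
  simp [Set.Pairwise, Function.onFun]

lemma admissible_map (Λ I : Finset W) {τ : V → Bool} (hτ : ∀ v ∉ Set.range e, τ v = false) :
    Admissible G (Λ.map e.toEmbedding) τ (I.map e.toEmbedding) ↔ Admissible H Λ (τ ∘ e) I := by
  refine and_congr (isIndepSet_map e I) ?_
  rw [Finset.forall_mem_map]
  refine forall₂_congr fun w _ => ⟨fun h x hx hwx => ?_, fun h u hu hwu => ?_⟩
  · exact h (e x) (by simpa using hx) (e.map_adj_iff.2 hwx)
  · by_cases hr : u ∈ Set.range e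
    · obtain ⟨x, rfl⟩ := hr
      exact h x (by simpa using hu) (e.map_adj_iff.1 hwu)
    · exact hτ u hr

lemma weight_map (lam : ℝ) (Λ I : Finset W) {τ : V → Bool}
    (hτ : ∀ v ∉ Set.range e, τ v = false) :
    weight G lam (Λ.map e.toEmbedding) τ (I.map e.toEmbedding) = weight H lam Λ (τ ∘ e) I := by
  classical
  rw [weight, weight, Finset.card_map]
  exact if_congr (admissible_map e Λ I hτ) rfl rfl

lemma gibbsSum_map (Λ : Finset W) {τ : V → Bool} (hτ : ∀ v ∉ Set.range e, τ v = false)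
    (f : (W → Bool) → ℝ) :
    gibbsSum G lam (Λ.map e.toEmbedding) τ (fun σ => f (σ ∘ e)) =
      gibbsSum H lam Λ (τ ∘ e) f := by
  simp only [gibbsSum, sum_powerset_map, glue_map_comp, weight_map e lam Λ _ hτ]

lemma condProb_map (Λ : Finset W) {τ : V → Bool} (hτ : ∀ v ∉ Set.range e, τ v = false)
    (A : Set (W → Bool)) :
    condProb G lam (Λ.map e.toEmbedding) τ ((· ∘ e) ⁻¹' A) = condProb H lam Λ (τ ∘ e) A := by
  rw [condProb_eq_div, condProb_eq_div, ← gibbsSum_map e Λ hτ, ← gibbsSum_map e Λ hτ]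
  rfl

lemma cylinder_map (X : Finset W) (s : V → Bool) :
    cylinder (X.map e.toEmbedding) s = (· ∘ e) ⁻¹' cylinder X (s ∘ e) := by
  ext σ
  simp [cylinder]

lemma IsIndependent.extend {σ : W → Bool} (hσ : IsIndependent H σ) :
    IsIndependent G (Function.extend e σ fun _ => false) := by
  rintro u v huv ⟨hu, hv⟩
  have hrange {v : V} (hv : Function.extend e σ (fun _ => false) v = true) :
      v ∈ Set.range e := by
    by_contra h
    simp [Function.extend_apply' _ _ _ h] at hv
  obtain ⟨x, rfl⟩ := hrange hu
  obtain ⟨y, rfl⟩ := hrange hv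
  rw [e.injective.extend_apply] at hu hv
  exact hσ x y (e.map_adj_iff.1 huv) ⟨hu, hv⟩

lemma finite_ball (hG : ∀ v, (G.neighborSet v).Finite) (r : ℕ) {X : Set V} (hX : X.Finite) :
    (ball G X r).Finite := by
  induction r generalizing X with
  | zero =>
    refine hX.subset ?_
    rintro u ⟨v, hv, hvu⟩
    simp_all
  | succ r ih =>
    refine (hX.union (ih (hX.biUnion fun v _ => hG v))).subset ?_
    rintro u ⟨v, hv, hvu⟩
    obtain ⟨p, hp⟩ := SimpleGraph.exists_walk_of_edist_ne_top
      (ne_top_of_le_ne_top (ENat.natCast_ne_top _) hvu)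
    cases p with
    | nil => exact .inl hv
    | @cons _ w _ hvw q =>
      rw [← hp, SimpleGraph.Walk.length_cons, Nat.cast_le, Nat.add_le_add_iff_right] at hvu
      exact .inr ⟨w, Set.mem_biUnion hv hvw, q.edist_le.trans (Nat.cast_le.2 hvu)⟩

lemma StrongSpatialMixing.spatialMixing_of_embedding (h : StrongSpatialMixing G lam)
    (hG : ∀ v, (G.neighborSet v).Finite) (e : H ↪g G) : SpatialMixing H lam := by
  classical
  intro X s ε hε
  obtain ⟨R, hR, hmix⟩ := h (X.map e.toEmbedding) (Set.range e)ᶜ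
  obtain ⟨r, hRr, hr⟩ := ((hR.eventually_le_const hε).and (eventually_ge_atTop 1)).exists
  set B := ball G (X.map e.toEmbedding : Finset V) r
  have hfin : (e ⁻¹' (B \ ((Set.range e)ᶜ ∪ boundary G B))).Finite :=
    ((finite_ball hG r (Finset.finite_toSet _)).subset Set.sdiff_subset).preimage
      e.injective.injOn
  have hfree : (hfin.toFinset.map e.toEmbedding : Set V) =
      B \ ((Set.range e)ᶜ ∪ boundary G B) := by
    rw [Finset.coe_map, hfin.coe_toFinset]
    refine Set.image_preimage_eq_of_subset fun v hv => ?_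
    exact not_not.1 fun hvr => hv.2 (.inl hvr)
  have hext (σ : W → Bool) : ∀ v ∉ Set.range e, Function.extend e σ (fun _ => false) v = false :=
    fun v hv => Function.extend_apply' _ _ _ hv
  have hcond (σ : W → Bool) : condProb H lam hfin.toFinset σ (cylinder X s) =
      condProb G lam (hfin.toFinset.map e.toEmbedding) (Function.extend e σ fun _ => false)
        (cylinder (X.map e.toEmbedding) (Function.extend e s fun _ => false)) := by
    rw [cylinder_map, condProb_map e _ (hext σ), Function.extend_comp e.injective,
      Function.extend_comp e.injective]
  refine ⟨hfin.toFinset, fun τ τ' hτ hτ' => ?_⟩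
  rw [hcond, hcond]
  exact (hmix r hr _ hfree _ _ _ (hτ.extend e) (hτ'.extend e) fun v hv =>
    (hext τ v hv).trans (hext τ' v hv).symm).trans hRr

end Embedding

/-! ### Partition functions -/

section PartitionFunction

variable (G : SimpleGraph V) {lam : ℝ}

open Classical in
lemma weight_false (lam : ℝ) (Λ I : Finset V) :
    weight G lam Λ (fun _ => false) I =
      if G.IsIndepSet (I : Set V) then lam ^ I.card else 0 :=
  if_congr (and_iff_left fun _ _ _ _ _ => rfl) rfl rfl

lemma gibbsSum_false_one (lam : ℝ) (Λ : Finset V) :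
    gibbsSum G lam Λ (fun _ => false) 1 = partitionFunction G lam Λ := by
  simp [gibbsSum, weight_false, partitionFunction, Finset.sum_filter]

lemma partitionFunction_pos (hlam : 0 ≤ lam) (Λ : Finset V) : 0 < partitionFunction G lam Λ :=
  gibbsSum_false_one G lam Λ ▸ gibbsSum_one_pos G Λ _ hlam

lemma partitionFunction_map {W : Type*} {G : SimpleGraph V} {H : SimpleGraph W} (e : H ↪g G)
    (lam : ℝ) (Λ : Finset W) :
    partitionFunction G lam (Λ.map e.toEmbedding) = partitionFunction H lam Λ := by
  rw [← gibbsSum_false_one, ← gibbsSum_false_one]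
  exact gibbsSum_map e Λ (fun _ _ => rfl) 1

lemma partitionFunction_of_isIndepSet (lam : ℝ) {Λ : Finset V}
    (h : G.IsIndepSet (Λ : Set V)) : partitionFunction G lam Λ = (1 + lam) ^ Λ.card := by
  classical
  rw [partitionFunction, Finset.filter_true_of_mem fun I hI =>
    h.mono (Finset.coe_subset.2 (Finset.mem_powerset.1 hI)), add_comm,
    ← Finset.sum_pow_mul_eq_add_pow]
  simp only [one_pow, mul_one]

variable [DecidableEq V]

lemma partitionFunction_le_insert (hlam : 0 ≤ lam) (Λ : Finset V) (v : V) :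
    partitionFunction G lam Λ ≤ partitionFunction G lam (insert v Λ) := by
  refine Finset.sum_le_sum_of_subset_of_nonneg (fun I hI => ?_) fun _ _ _ => pow_nonneg hlam _
  simp only [Finset.mem_filter, Finset.mem_powerset] at hI ⊢
  exact ⟨hI.1.trans (Finset.subset_insert v Λ), hI.2⟩

lemma partitionFunction_insert_le (hlam : 0 ≤ lam) {Λ : Finset V} {v : V} (hv : v ∉ Λ) :
    partitionFunction G lam (insert v Λ) ≤ (1 + lam) * partitionFunction G lam Λ := by
  classical
  simp only [partitionFunction, Finset.sum_filter]
  rw [Finset.sum_powerset_insert hv, add_mul, one_mul, Finset.mul_sum]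
  gcongr with I hI
  rw [Finset.card_insert_of_notMem fun h => hv (Finset.mem_powerset.1 hI h), pow_succ',
    mul_ite, mul_zero]
  by_cases h : G.IsIndepSet (I : Set V)
  · split_ifs <;> first | rfl | positivity
  · rw [if_neg h, if_neg fun hins => h (hins.mono (by simp))]

/-- The probability that `o` is vacant in the finite volume `T ∋ o` with empty boundary
condition, written as a ratio of partition functions. -/
def vacancyRatio (G : SimpleGraph V) (lam : ℝ) (T : Finset V) (o : V) : ℝ :=
  partitionFunction G lam (T.erase o) / partitionFunction G lam T

lemma condProb_vacant (lam : ℝ) {T : Finset V} {o : V} (ho : o ∈ T) :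
    condProb G lam T (fun _ => false) {σ | σ o = false} = vacancyRatio G lam T o := by
  classical
  rw [condProb_eq_div, gibbsSum_false_one, vacancyRatio]
  congr 1
  have hsub : (T.erase o).powerset ⊆ T.powerset := Finset.powerset_mono.2 (T.erase_subset o)
  have hglue (I : Finset V) :
      glue T (fun _ => false) I ∈ {σ : V → Bool | σ o = false} ↔ o ∉ I := by
    rw [Set.mem_ofPred_eq, ← glue_apply_of_mem ho, Bool.not_eq_true]
  rw [← gibbsSum_false_one]
  refine (Finset.sum_subset_zero_on_sdiff hsub (fun I hI => ?_) fun I hI => ?_).symm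
  · rw [Finset.mem_sdiff, Finset.mem_powerset, Finset.mem_powerset, Finset.subset_erase] at hI
    have hoI : o ∈ I := not_not.1 fun h => hI.2 ⟨hI.1, h⟩
    rw [Set.indicator_of_notMem fun h => (hglue I).1 h hoI, mul_zero]
  · have hoI : o ∉ I := (Finset.subset_erase.1 (Finset.mem_powerset.1 hI)).2
    rw [weight_false, weight_false, Set.indicator_of_mem ((hglue I).2 hoI)]
    rfl

lemma vacancyRatio_map {W : Type*} [DecidableEq W] {G : SimpleGraph V} {H : SimpleGraph W}
    (e : H ↪g G) (lam : ℝ) (T : Finset W) (o : W) :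
    vacancyRatio G lam (T.map e.toEmbedding) (e o) = vacancyRatio H lam T o := by
  rw [vacancyRatio, vacancyRatio, ← partitionFunction_map e, ← partitionFunction_map e,
    Finset.map_erase]
  rfl

lemma vacancyRatio_insert (lam : ℝ) {A : Finset V} {v : V} (hv : v ∉ A) :
    vacancyRatio G lam (insert v A) v =
      partitionFunction G lam A / partitionFunction G lam (insert v A) := by
  rw [vacancyRatio, Finset.erase_insert hv]

lemma inv_one_add_le_vacancyRatio (hlam : 0 ≤ lam) (T : Finset V) (o : V) :
    (1 + lam)⁻¹ ≤ vacancyRatio G lam T o := by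
  have hle : partitionFunction G lam T ≤ (1 + lam) * partitionFunction G lam (T.erase o) := by
    by_cases ho : o ∈ T
    · simpa only [Finset.insert_erase ho] using
        partitionFunction_insert_le G hlam (T.notMem_erase o)
    · rw [Finset.erase_eq_of_notMem ho]
      exact le_mul_of_one_le_left (partitionFunction_pos G hlam T).le (by linarith)
  rw [vacancyRatio, le_div_iff₀ (partitionFunction_pos G hlam T)]
  exact (inv_mul_le_iff₀ (by positivity)).2 hle

lemma vacancyRatio_le_one (hlam : 0 ≤ lam) (T : Finset V) (o : V) :
    vacancyRatio G lam T o ≤ 1 := by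
  refine div_le_one_of_le₀ ?_ (partitionFunction_pos G hlam T).le
  by_cases ho : o ∈ T
  · simpa only [Finset.insert_erase ho] using partitionFunction_le_insert G hlam (T.erase o) o
  · rw [Finset.erase_eq_of_notMem ho]

lemma abs_log_vacancyRatio_le (hlam : 0 ≤ lam) (T : Finset V) (o : V) :
    |-Real.log (vacancyRatio G lam T o)| ≤ Real.log (1 + lam) := by
  have hpos : 0 < (1 + lam)⁻¹ := by positivity
  have hge := inv_one_add_le_vacancyRatio G hlam T o
  rw [abs_neg, abs_of_nonpos (Real.log_nonpos (hpos.le.trans hge) (vacancyRatio_le_one G hlam T o)),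
    neg_le, ← Real.log_inv]
  exact Real.log_le_log hpos hge

end PartitionFunction

lemma SpatialMixing.tendsto_log_vacancyRatio [Countable V] [DecidableEq V] {G : SimpleGraph V}
    {lam : ℝ} (h : SpatialMixing G lam) (hlam : 0 ≤ lam) {μ : Measure (V → Bool)}
    (hμ : IsGibbs G lam μ) (o : V) :
    Tendsto (fun T => -Real.log (vacancyRatio G lam T o)) atTop
      (𝓝 (-Real.log (μ.real {σ | σ o = false}))) := by
  have hlim : Tendsto (fun T => vacancyRatio G lam T o) atTop (𝓝 (μ.real {σ | σ o = false})) := by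
    rw [← cylinder_singleton o fun _ => false]
    refine (h.tendsto_condProb hlam hμ {o} fun _ => false).congr' ?_
    filter_upwards [eventually_ge_atTop {o}] with T hT
    rw [cylinder_singleton, condProb_vacant G lam (Finset.singleton_subset_iff.1 hT)]
  have hpos : 0 < (1 + lam)⁻¹ := by positivity
  exact (hlim.log (hpos.trans_le (ge_of_tendsto' hlim fun T =>
    inv_one_add_le_vacancyRatio G hlam T o)).ne').neg

/-! ### The chain rule along an order -/

section ChainRule

lemma sum_insert_filter_sub {α M : Type*} [DecidableEq α] [AddCommGroup M] (r : α → α → Prop)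
    [DecidableRel r] [IsStrictTotalOrder α r] (F : Finset α → M) (Λ : Finset α) :
    ∑ v ∈ Λ, (F (insert v {u ∈ Λ | r u v}) - F {u ∈ Λ | r u v}) = F Λ - F ∅ := by
  let _ : LinearOrder α := linearOrderOfSTO r
  have hlt (a b : α) : r a b ↔ a < b := Iff.rfl
  simp only [hlt]
  induction Λ using Finset.induction_on_max with
  | empty => simp
  | insert m Λ hm ih =>
    have hmΛ : m ∉ Λ := fun h => lt_irrefl m (hm m h)
    have hbelow_max : {u ∈ insert m Λ | u < m} = Λ := by
      rw [Finset.filter_insert, if_neg (lt_irrefl m), Finset.filter_true_of_mem hm]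
    have hbelow (v) (hv : v ∈ Λ) : {u ∈ insert m Λ | u < v} = {u ∈ Λ | u < v} := by
      rw [Finset.filter_insert, if_neg (hm v hv).not_gt]
    rw [Finset.sum_insert hmΛ, hbelow_max, Finset.sum_congr rfl fun v hv => by rw [hbelow v hv],
      ih, sub_add_sub_cancel]

lemma log_partitionFunction_union [DecidableEq V] (G : SimpleGraph V) {lam : ℝ} (hlam : 0 ≤ lam)
    (r : V → V → Prop) [DecidableRel r] [IsStrictTotalOrder V r] {E O : Finset V}
    (hEO : Disjoint E O) :
    Real.log (partitionFunction G lam (E ∪ O)) = Real.log (partitionFunction G lam O) +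
      ∑ v ∈ E, -Real.log (vacancyRatio G lam (insert v ({u ∈ E | r u v} ∪ O)) v) := by
  have htelescope := sum_insert_filter_sub r
    (fun A => Real.log (partitionFunction G lam (A ∪ O))) E
  rw [Finset.empty_union, eq_sub_iff_add_eq'] at htelescope
  rw [← htelescope]
  congr 1
  refine Finset.sum_congr rfl fun v hv => ?_
  have hnot : v ∉ {u ∈ E | r u v} ∪ O := by
    rw [Finset.mem_union, Finset.mem_filter]
    exact not_or.2 ⟨fun h => irrefl_of r v h.2, Finset.disjoint_left.1 hEO hv⟩
  rw [vacancyRatio_insert G lam hnot, Finset.insert_union,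
    Real.log_div (partitionFunction_pos G hlam _).ne' (partitionFunction_pos G hlam _).ne',
    neg_sub]

end ChainRule

/-! ### Averages along Følner sequences -/

section Folner

variable {ι : Type*} {l : Filter ι} [AddGroup V]

/-- The part in `S` of the finite set `Λ` seen from `v`, that is, of the translate of `Λ` which
takes `v` to the origin. -/
def view (S : Set V) (Λ : Finset V) (v : V) : Finset S :=
  Λ.preimage (fun w : S => (w : V) + v)
    ((add_left_injective v).comp Subtype.val_injective).injOn

lemma mem_view {S : Set V} {Λ : Finset V} {v : V} {w : S} :
    w ∈ view S Λ v ↔ (w : V) + v ∈ Λ :=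
  Finset.mem_preimage

/-- The embedding `w ↦ w + v` of an induced subgraph of a translation invariant graph. -/
def translateEmbedding {G : SimpleGraph V} (hG : ∀ u w v, G.Adj (u + v) (w + v) ↔ G.Adj u w)
    (S : Set V) (v : V) : G.induce S ↪g G where
  toFun w := w + v
  inj' := (add_left_injective v).comp Subtype.val_injective
  map_rel_iff' := hG _ _ v

lemma map_view {G : SimpleGraph V} (hG : ∀ u w v, G.Adj (u + v) (w + v) ↔ G.Adj u w) (S : Set V)
    [DecidablePred (· ∈ S)] (Λ : Finset V) (v : V) :
    (view S Λ v).map (translateEmbedding hG S v).toEmbedding = {u ∈ Λ | u - v ∈ S} := by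
  ext u
  rw [Finset.mem_map, Finset.mem_filter]
  constructor
  · rintro ⟨w, hw, rfl⟩
    exact ⟨mem_view.1 hw, (add_sub_cancel_right (w : V) v).symm ▸ w.2⟩
  · rintro ⟨hu, huS⟩
    exact ⟨⟨u - v, huS⟩, mem_view.2 ((sub_add_cancel u v).symm ▸ hu), sub_add_cancel u v⟩

variable [DecidableEq V]

/-- The points of `Λ` which leave `Λ` under the translation by `u`. -/
def escape (Λ : Finset V) (u : V) : Finset V :=
  {v ∈ Λ | u + v ∉ Λ}

lemma mem_escape {Λ : Finset V} {u v : V} : v ∈ escape Λ u ↔ v ∈ Λ ∧ u + v ∉ Λ :=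
  Finset.mem_filter

lemma escape_zero (Λ : Finset V) : escape Λ 0 = ∅ := by
  simp [escape]

lemma card_escape_add_le (Λ : Finset V) (a b : V) :
    (escape Λ (a + b)).card ≤ (escape Λ a).card + (escape Λ b).card := by
  have hsub : escape Λ (a + b) ⊆ (escape Λ a).image (-b + ·) ∪ escape Λ b := by
    intro v hv
    rw [mem_escape, add_assoc] at hv
    rw [Finset.mem_union, Finset.mem_image, mem_escape]
    by_cases hvb : b + v ∈ Λ
    · exact .inl ⟨b + v, mem_escape.2 ⟨hvb, hv.2⟩, neg_add_cancel_left b v⟩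
    · exact .inr ⟨hv.1, hvb⟩
  exact (Finset.card_le_card hsub).trans
    ((Finset.card_union_le _ _).trans (Nat.add_le_add_right Finset.card_image_le _))

/-- The translations which move a negligible proportion of the points of `Λ n` out of `Λ n`. -/
def negligibleShifts (l : Filter ι) (Λ : ι → Finset V) : AddSubmonoid V where
  carrier := {u | Tendsto (fun n => ((escape (Λ n) u).card : ℝ) / (Λ n).card) l (𝓝 0)}
  zero_mem' := by
    simp only [Set.mem_ofPred_eq, escape_zero, Finset.card_empty, Nat.cast_zero, zero_div,
      tendsto_const_nhds]
  add_mem' {a b} ha hb := by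
    refine squeeze_zero (fun n => by positivity) (fun n => ?_) (add_zero (0 : ℝ) ▸ ha.add hb)
    rw [← add_div]
    gcongr
    exact_mod_cast card_escape_add_le (Λ n) a b

/-- Følner families of finite subsets of a group, for left translations: every translation moves
only a negligible proportion of their points out of them. -/
structure IsFolner (l : Filter ι) (Λ : ι → Finset V) : Prop where
  nonempty : ∀ n, (Λ n).Nonempty
  mem_negligibleShifts : ∀ u, u ∈ negligibleShifts l Λ

lemma IsFolner.card_pos {Λ : ι → Finset V} (h : IsFolner l Λ) (n : ι) : (0 : ℝ) < (Λ n).card :=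
  Nat.cast_pos.2 (h.nonempty n).card_pos

lemma card_filter_le_add_card_escape (Λ : Finset V) {p q : V → Prop} [DecidablePred p]
    [DecidablePred q] {e : V} (hpq : ∀ v, p v → q (e + v)) :
    (Λ.filter p).card ≤ (Λ.filter q).card + (escape Λ e).card := by
  have hsub : Λ.filter p ⊆ (Λ.filter q).image (-e + ·) ∪ escape Λ e := by
    intro v hv
    rw [Finset.mem_filter] at hv
    rw [Finset.mem_union, Finset.mem_image, mem_escape]
    by_cases hve : e + v ∈ Λ
    · exact .inl ⟨e + v, Finset.mem_filter.2 ⟨hve, hpq v hv.2⟩, neg_add_cancel_left e v⟩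
    · exact .inr ⟨hv.1, hve⟩
  exact (Finset.card_le_card hsub).trans
    ((Finset.card_union_le _ _).trans (Nat.add_le_add_right Finset.card_image_le _))

lemma IsFolner.tendsto_density_of_swap {Λ : ι → Finset V} (h : IsFolner l Λ) (p : V → Prop)
    [DecidablePred p] {e : V} (hp : ∀ v, p (e + v) ↔ ¬ p v) :
    Tendsto (fun n => (((Λ n).filter p).card : ℝ) / (Λ n).card) l (𝓝 (1 / 2)) := by
  rw [tendsto_iff_norm_sub_tendsto_zero]
  refine squeeze_zero (fun _ => norm_nonneg _) (fun n => ?_) (h.mem_negligibleShifts e)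
  have hcard := h.card_pos n
  have hle := card_filter_le_add_card_escape (Λ n) (q := (¬ p ·)) fun v hv hev =>
    (hp v).1 hev hv
  have hge := card_filter_le_add_card_escape (Λ n) fun v => (hp v).2
  have hsum := Finset.card_filter_add_card_filter_not (s := Λ n) p
  rify at hle hge hsum
  rw [Real.norm_eq_abs, div_sub' hcard.ne', abs_div, abs_of_pos hcard]
  gcongr
  rw [abs_le]
  constructor <;> linarith

lemma card_filter_not_subset_view_le {S : Set V} [DecidableEq S] (Λ : Finset V) (W : Finset S) :
    (Λ.filter fun v => ¬ W ⊆ view S Λ v).card ≤ ∑ w ∈ W, (escape Λ w).card := by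
  refine (Finset.card_le_card fun v hv => ?_).trans Finset.card_biUnion_le
  rw [Finset.mem_filter, Finset.not_subset] at hv
  obtain ⟨hv, w, hw, hwv⟩ := hv
  exact Finset.mem_biUnion.2 ⟨w, hw, mem_escape.2 ⟨hv, mt mem_view.2 hwv⟩⟩

lemma IsFolner.tendsto_card_not_subset_view {Λ : ι → Finset V} (h : IsFolner l Λ) {S : Set V}
    [DecidableEq S] (W : Finset S) :
    Tendsto (fun n => (((Λ n).filter fun v => ¬ W ⊆ view S (Λ n) v).card : ℝ) / (Λ n).card) l
      (𝓝 0) := by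
  have hsum := tendsto_finsetSum W fun w _ => h.mem_negligibleShifts (w : V)
  rw [Finset.sum_const_zero] at hsum
  refine squeeze_zero (fun n => by positivity) (fun n => ?_) hsum
  rw [← Finset.sum_div]
  gcongr
  exact_mod_cast card_filter_not_subset_view_le (Λ n) W

lemma abs_sum_filter_le {α : Type*} (Λ : Finset α) (p good : α → Prop) [DecidablePred p]
    [DecidablePred good] {g : α → ℝ} {C ε : ℝ} (hε : 0 ≤ ε) (hC : ∀ v ∈ Λ, |g v| ≤ C)
    (hgood : ∀ v ∈ Λ, good v → |g v| ≤ ε) :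
    |∑ v ∈ Λ with p v, g v| ≤ ε * Λ.card + C * (Λ.filter fun v => ¬ good v).card :=
  calc |∑ v ∈ Λ with p v, g v|
      ≤ ∑ v ∈ Λ with p v, |g v| := Finset.abs_sum_le_sum_abs _ _
    _ ≤ ∑ v ∈ Λ, |g v| := Finset.sum_le_sum_of_subset_of_nonneg (Finset.filter_subset _ _)
        fun _ _ _ => abs_nonneg _
    _ ≤ ∑ v ∈ Λ, (ε + if ¬ good v then C else 0) := by
        refine Finset.sum_le_sum fun v hv => ?_
        by_cases hg : good v
        · simpa only [hg, not_true, if_false, add_zero] using hgood v hv hg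
        · simpa only [hg, not_false_eq_true, if_true] using
            (hC v hv).trans (le_add_of_nonneg_left hε)
    _ = ε * Λ.card + C * (Λ.filter fun v => ¬ good v).card := by
        rw [Finset.sum_add_distrib, ← Finset.sum_filter, Finset.sum_const, Finset.sum_const,
          nsmul_eq_mul, nsmul_eq_mul, mul_comm, mul_comm C]

lemma IsFolner.tendsto_average {Λ : ι → Finset V} (h : IsFolner l Λ) {S : Set V}
    {p : V → Prop} [DecidablePred p] {f : Finset S → ℝ} {a c C : ℝ} (hC : ∀ T, |f T| ≤ C)
    (hf : Tendsto f atTop (𝓝 a))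
    (hp : Tendsto (fun n => (((Λ n).filter p).card : ℝ) / (Λ n).card) l (𝓝 c)) :
    Tendsto (fun n => (∑ v ∈ Λ n with p v, f (view S (Λ n) v)) / (Λ n).card) l (𝓝 (c * a)) := by
  classical
  have hzero : Tendsto (fun n => (∑ v ∈ Λ n with p v, (f (view S (Λ n) v) - a)) / (Λ n).card) l
      (𝓝 0) := by
    rw [Metric.tendsto_nhds]
    intro ε hε
    obtain ⟨W, hW⟩ := Metric.tendsto_atTop.1 hf (ε / 2) (half_pos hε)
    have hbad := (h.tendsto_card_not_subset_view W).const_mul (C + |a|)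
    rw [mul_zero] at hbad
    filter_upwards [hbad.eventually_lt_const (half_pos hε)] with n hn
    have hcard := h.card_pos n
    have hsum := abs_sum_filter_le (Λ n) p (fun v => W ⊆ view S (Λ n) v) (half_pos hε).le
      (fun v _ => (abs_sub _ a).trans (add_le_add_left (hC (view S (Λ n) v)) _))
      fun v _ hv => (hW _ hv).le
    rw [← mul_div_assoc, div_lt_iff₀ hcard] at hn
    rw [Real.dist_eq, sub_zero, abs_div, abs_of_pos hcard, div_lt_iff₀ hcard]
    linarith
  have hadd := hzero.add (hp.mul_const a)
  rw [zero_add] at hadd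
  refine hadd.congr fun n => ?_
  rw [Finset.sum_sub_distrib, Finset.sum_const, nsmul_eq_mul]
  ring

lemma IsFolner.tendsto_average_log_vacancyRatio [Countable V] {Λ : ι → Finset V}
    (h : IsFolner l Λ) {G : SimpleGraph V}
    (hG : ∀ u w v, G.Adj (u + v) (w + v) ↔ G.Adj u w) {lam : ℝ} (hlam : 0 ≤ lam) {S : Set V}
    [DecidablePred (· ∈ S)] (hmix : SpatialMixing (G.induce S) lam) {μ : Measure (S → Bool)}
    (hμ : IsGibbs (G.induce S) lam μ) {o : S} (ho : (o : V) = 0) {p : V → Prop} [DecidablePred p]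
    {c : ℝ} (hp : Tendsto (fun n => (((Λ n).filter p).card : ℝ) / (Λ n).card) l (𝓝 c)) :
    Tendsto (fun n => (∑ v ∈ Λ n with p v,
      -Real.log (vacancyRatio G lam {u ∈ Λ n | u - v ∈ S} v)) / (Λ n).card) l
      (𝓝 (c * -Real.log (μ.real {σ | σ o = false}))) := by
  refine (h.tendsto_average (fun T => abs_log_vacancyRatio_le (G.induce S) hlam T o)
    (hmix.tendsto_log_vacancyRatio hlam hμ o) hp).congr fun n => ?_
  congr 1
  refine Finset.sum_congr rfl fun v _ => ?_
  have horigin : translateEmbedding hG S v o = v :=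
    (congrArg (· + v) ho).trans (zero_add v)
  rw [← vacancyRatio_map (translateEmbedding hG S v), map_view, horigin]

end Folner

/-! ### The lattice -/

section Lattice

variable {d : ℕ}

lemma lattice_adj {u v : Fin d → ℤ} : (lattice d).Adj u v ↔ ∑ j, |u j - v j| = 1 := Iff.rfl

lemma lattice_adj_add_right (u w v : Fin d → ℤ) :
    (lattice d).Adj (u + v) (w + v) ↔ (lattice d).Adj u w := by
  simp only [lattice_adj, Pi.add_apply, add_sub_add_right_eq_sub]

lemma abs_sub_le_one_of_adj {u v : Fin d → ℤ} (h : (lattice d).Adj u v) (j : Fin d) :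
    |u j - v j| ≤ 1 :=
  (Finset.single_le_sum (f := fun j => |u j - v j|) (fun _ _ => abs_nonneg _)
    (Finset.mem_univ j)).trans_eq h

lemma finite_neighborSet_lattice (v : Fin d → ℤ) : ((lattice d).neighborSet v).Finite := by
  refine (Set.finite_Icc (v - 1) (v + 1)).subset fun u hu => ⟨fun j => ?_, fun j => ?_⟩ <;>
  · have habs := abs_le.1 (abs_sub_le_one_of_adj hu j)
    simp only [Pi.sub_apply, Pi.add_apply, Pi.one_apply]
    omega

lemma lattice_adj_single_add (i : Fin d) {c : ℤ} (hc : |c| = 1) (v : Fin d → ℤ) :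
    (lattice d).Adj v (Pi.single i c + v) := by
  rw [lattice_adj, Finset.sum_eq_single i]
  · simp [hc]
  · intro j _ hj
    simp [hj]
  · simp

lemma odd_sum_iff_not_odd_of_adj {u v : Fin d → ℤ} (h : (lattice d).Adj u v) :
    Odd (∑ j, u j) ↔ ¬ Odd (∑ j, v j) := by
  have heven : Even (∑ j, (|u j - v j| - (u j - v j))) :=
    Finset.even_sum _ fun j _ => by rw [Int.even_sub, even_abs]
  rw [Finset.sum_sub_distrib, lattice_adj.1 h, Finset.sum_sub_distrib, Int.even_sub,
    Int.even_sub] at heven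
  simp only [← Int.not_even_iff_odd]
  have hone : ¬ Even (1 : ℤ) := Int.not_even_one
  tauto

lemma odd_sum_single_add_iff (i : Fin d) (v : Fin d → ℤ) :
    Odd (∑ j, (Pi.single i (1 : ℤ) + v : Fin d → ℤ) j) ↔ ¬ Odd (∑ j, v j) :=
  odd_sum_iff_not_odd_of_adj (lattice_adj_single_add i abs_one v).symm

lemma isIndepSet_of_forall_odd {O : Set (Fin d → ℤ)} (hO : ∀ v ∈ O, Odd (∑ j, v j)) :
    (lattice d).IsIndepSet O :=
  fun _ hu _ hv _ huv => (odd_sum_iff_not_odd_of_adj huv).1 (hO _ hu) (hO _ hv)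

lemma prec_iff_toColex_lt {u v : Fin d → ℤ} : Prec u v ↔ toColex u < toColex v :=
  exists_congr fun _ => and_comm

instance isStrictTotalOrder_prec : IsStrictTotalOrder (Fin d → ℤ) Prec :=
  have : IsStrictTotalOrder (Colex (Fin d → ℤ)) (· < ·) := instIsStrictTotalOrderLt
  (⟨toColex.toEmbedding, prec_iff_toColex_lt.symm⟩ :
    (Prec : (Fin d → ℤ) → (Fin d → ℤ) → Prop) ↪r (· < ·)).isStrictTotalOrder

lemma sub_mem_past {u v : Fin d → ℤ} : u - v ∈ past d ↔ Prec u v ∨ u = v := by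
  simp [past, Prec, sub_eq_zero, or_comm]

lemma sub_mem_pastEven {u v : Fin d → ℤ} (hv : ¬ Odd (∑ j, v j)) :
    u - v ∈ pastEven d ↔ (Prec u v ∨ u = v) ∨ Odd (∑ j, u j) := by
  have hodd : Odd (∑ j, (u - v) j) ↔ Odd (∑ j, u j) := by
    simp only [Pi.sub_apply, Finset.sum_sub_distrib, Int.odd_sub, Int.not_odd_iff_even.1 hv,
      iff_true]
  have hprec : Prec 0 (u - v) ↔ Prec v u := by simp [Prec, eq_comm, sub_eq_zero]
  rw [pastEven, Set.mem_union, sub_mem_past, Set.mem_ofPred_eq, hodd, hprec]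
  have htri := trichotomous_of Prec u v
  tauto

/-! ### Van Hove sequences -/

lemma mem_of_forall_single_mem {M : AddSubmonoid (Fin d → ℤ)}
    (hM : ∀ (i : Fin d) (c : ℤ), |c| = 1 → Pi.single i c ∈ M) (u : Fin d → ℤ) : u ∈ M := by
  rw [← Finset.univ_sum_single u]
  refine M.sum_mem fun i _ => ?_
  induction u i using Int.induction_on with
  | zero => simp
  | succ n ih =>
    rw [Pi.single_add]
    exact M.add_mem ih (hM i 1 abs_one)
  | pred n ih =>
    rw [sub_eq_add_neg, Pi.single_add]
    exact M.add_mem ih (hM i (-1) (by simp))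

lemma IsVanHove.isFolner {Λ : ℕ → Finset (Fin d → ℤ)} (h : IsVanHove Λ) : IsFolner atTop Λ where
  nonempty n := ⟨0, h.monotone (Nat.zero_le n) h.zero_mem⟩
  mem_negligibleShifts := mem_of_forall_single_mem fun i c hc => by
    refine squeeze_zero (fun n => by positivity) (fun n => ?_) h.boundary_small
    gcongr
    rw [← Set.ncard_coe_finset]
    refine Set.ncard_le_ncard (fun v hv => ?_) ((Λ n).finite_toSet.subset fun v hv => hv.1)
    have hv := mem_escape.1 hv
    exact ⟨hv.1, _, lattice_adj_single_add i hc v, hv.2⟩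

/-- The box `[-n, n]^d`. -/
def box (d n : ℕ) : Finset (Fin d → ℤ) :=
  Finset.Icc (fun _ => -(n : ℤ)) fun _ => (n : ℤ)

lemma mem_box {n : ℕ} {v : Fin d → ℤ} : v ∈ box d n ↔ ∀ j, |v j| ≤ n := by
  simp only [box, Finset.mem_Icc, Pi.le_def, abs_le, forall_and]

lemma box_mono : Monotone (box d) := fun _ _ hmn _ hv =>
  mem_box.2 fun j => (mem_box.1 hv j).trans (Nat.cast_le.2 hmn)

lemma card_box (d n : ℕ) : (box d n).card = (2 * n + 1) ^ d := by
  rw [box, Pi.card_Icc]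
  simp only [Int.card_Icc, Finset.prod_const, Finset.card_univ, Fintype.card_fin]
  congr 1
  omega

lemma mem_box_succ_of_adj {n : ℕ} {u v : Fin d → ℤ} (hv : v ∈ box d n)
    (h : (lattice d).Adj v u) : u ∈ box d (n + 1) := by
  refine mem_box.2 fun j => ?_
  have hvj := abs_le.1 (mem_box.1 hv j)
  have huj := abs_le.1 (abs_sub_le_one_of_adj h j)
  rw [abs_le, Nat.cast_add_one]
  omega

lemma mem_box_of_walk {u v : Fin d → ℤ} (p : (lattice d).Walk u v) {n : ℕ} (hu : u ∈ box d n) :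
    v ∈ box d (n + p.length) := by
  induction p generalizing n with
  | nil => exact hu
  | cons h q ih =>
    rw [SimpleGraph.Walk.length_cons, add_comm q.length, ← add_assoc]
    exact ih (mem_box_succ_of_adj hu h)

lemma ball_subset_box {r n : ℕ} (hrn : r ≤ n) :
    ball (lattice d) {0} r ⊆ (box d n : Set (Fin d → ℤ)) := by
  rintro u ⟨v, rfl, hvu⟩
  obtain ⟨p, hp⟩ := SimpleGraph.exists_walk_of_edist_ne_top
    (ne_top_of_le_ne_top (ENat.natCast_ne_top r) hvu)
  rw [← hp, Nat.cast_le] at hvu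
  refine box_mono ((Nat.zero_add _).trans_le (hvu.trans hrn)) (mem_box_of_walk p ?_)
  exact mem_box.2 fun j => by simp

lemma ncard_boundary_box_le (d n : ℕ) :
    (boundary (lattice d) (box d (n + 1) : Set (Fin d → ℤ))).ncard ≤
      (box d (n + 1)).card - (box d n).card := by
  rw [← Finset.card_sdiff_of_subset (box_mono n.le_succ), ← Set.ncard_coe_finset]
  refine Set.ncard_le_ncard ?_ (Finset.finite_toSet _)
  rintro v ⟨hv, u, hvu, hu⟩
  exact Finset.mem_sdiff.2 ⟨hv, fun hvn => hu (mem_box_succ_of_adj hvn hvu)⟩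

lemma tendsto_ncard_boundary_box_div_card (d : ℕ) :
    Tendsto (fun n => ((boundary (lattice d) (box d n : Set (Fin d → ℤ))).ncard : ℝ) /
      (box d n).card) atTop (𝓝 0) := by
  rw [← tendsto_add_atTop_iff_nat 1]
  have hlim : Tendsto (fun n : ℕ => 1 - ((1 + 2 * n : ℝ) / (3 + 2 * n)) ^ d) atTop (𝓝 0) := by
    have hratio := tendsto_add_mul_div_add_mul_atTop_nhds (1 : ℝ) 3 2 (two_ne_zero (α := ℝ))
    simpa using (hratio.pow d).const_sub 1
  refine squeeze_zero (fun n => by positivity) (fun n => ?_) hlim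
  have hle : ((boundary (lattice d) (box d (n + 1) : Set (Fin d → ℤ))).ncard : ℝ) ≤
      (box d (n + 1)).card - (box d n).card := by
    rw [← Nat.cast_sub (Finset.card_le_card (box_mono n.le_succ))]
    exact_mod_cast ncard_boundary_box_le d n
  have hcard : ((box d (n + 1)).card : ℝ) = (3 + 2 * n) ^ d := by
    rw [card_box]
    push_cast
    ring
  rw [div_le_iff₀ (by rw [hcard]; positivity), sub_mul, one_mul, hcard, ← mul_pow,
    div_mul_cancel₀ _ (by positivity), ← hcard]
  rw [card_box d n] at hle
  push_cast at hle
  rwa [add_comm (1 : ℝ)]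

lemma isVanHove_box (d : ℕ) : IsVanHove (box d) where
  zero_mem := mem_box.2 fun j => by simp
  monotone := box_mono
  exhausts r := (eventually_ge_atTop r).mono fun _ => ball_subset_box
  boundary_small := tendsto_ncard_boundary_box_div_card d

/-! ### The free energy -/

lemma log_partitionFunction_eq_sum_past {lam : ℝ} (hlam : 0 ≤ lam) (A : Finset (Fin d → ℤ))
    [DecidablePred (· ∈ past d)] :
    Real.log (partitionFunction (lattice d) lam A) =
      ∑ v ∈ A, -Real.log (vacancyRatio (lattice d) lam {u ∈ A | u - v ∈ past d} v) := by
  classical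
  have hempty : partitionFunction (lattice d) lam ∅ = 1 := by
    rw [partitionFunction_of_isIndepSet _ _ (by simp), Finset.card_empty, pow_zero]
  have hchain := log_partitionFunction_union (lattice d) hlam Prec (Finset.disjoint_empty_right A)
  rw [Finset.union_empty, hempty, Real.log_one, zero_add] at hchain
  rw [hchain]
  refine Finset.sum_congr rfl fun v hv => ?_
  congr 3
  ext u
  simp only [Finset.mem_insert, Finset.mem_union, Finset.mem_filter, Finset.notMem_empty,
    sub_mem_past]
  grind

lemma log_partitionFunction_eq_sum_pastEven {lam : ℝ} (hlam : 0 ≤ lam) (A : Finset (Fin d → ℤ))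
    [DecidablePred (· ∈ pastEven d)] :
    Real.log (partitionFunction (lattice d) lam A) =
      (A.filter fun v => Odd (∑ j, v j)).card * Real.log (1 + lam) +
        ∑ v ∈ A with ¬ Odd (∑ j, v j),
          -Real.log (vacancyRatio (lattice d) lam {u ∈ A | u - v ∈ pastEven d} v) := by
  classical
  set O := A.filter fun v => Odd (∑ j, v j) with hO
  set E := A.filter fun v => ¬ Odd (∑ j, v j) with hE
  have hunion : E ∪ O = A := by
    rw [Finset.union_comm, hE, hO, Finset.filter_union_filter_not_eq]
  have hindep : (lattice d).IsIndepSet (O : Set (Fin d → ℤ)) :=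
    isIndepSet_of_forall_odd fun v hv => (Finset.mem_filter.1 hv).2
  have hchain := log_partitionFunction_union (lattice d) hlam Prec
    (Finset.disjoint_filter_filter_not A A fun v => Odd (∑ j, v j)).symm
  rw [← hO, ← hE, hunion, partitionFunction_of_isIndepSet _ _ hindep, Real.log_pow] at hchain
  rw [hchain]
  congr 1
  refine Finset.sum_congr rfl fun v hv => ?_
  have hv := Finset.mem_filter.1 hv
  congr 3
  ext u
  simp only [hE, hO, Finset.mem_insert, Finset.mem_union, Finset.mem_filter,
    sub_mem_pastEven hv.2]
  grind

variable {Λ : ℕ → Finset (Fin d → ℤ)} {lam : ℝ}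

lemma IsVanHove.tendsto_past (h : IsVanHove Λ) (hlam : 0 ≤ lam)
    (hmix : SpatialMixing ((lattice d).induce (past d)) lam) {μ : Measure (past d → Bool)}
    (hμ : IsGibbs ((lattice d).induce (past d)) lam μ) :
    Tendsto (fun n => Real.log (partitionFunction (lattice d) lam (Λ n)) / (Λ n).card) atTop
      (𝓝 (-Real.log (μ.real {σ | σ (pastOrigin d) = false}))) := by
  classical
  have hall : Tendsto (fun n => (((Λ n).filter fun _ => True).card : ℝ) / (Λ n).card) atTop
      (𝓝 1) := by
    refine tendsto_const_nhds.congr fun n => ?_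
    rw [Finset.filter_true, div_self (h.isFolner.card_pos n).ne']
  have hlim := h.isFolner.tendsto_average_log_vacancyRatio lattice_adj_add_right hlam hmix hμ
    (o := pastOrigin d) rfl hall
  rw [one_mul] at hlim
  refine hlim.congr fun n => ?_
  rw [log_partitionFunction_eq_sum_past hlam, Finset.filter_true]

lemma IsVanHove.tendsto_pastEven (h : IsVanHove Λ) (hd : 1 ≤ d) (hlam : 0 ≤ lam)
    (hmix : SpatialMixing ((lattice d).induce (pastEven d)) lam)
    {ν : Measure (pastEven d → Bool)} (hν : IsGibbs ((lattice d).induce (pastEven d)) lam ν) :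
    Tendsto (fun n => Real.log (partitionFunction (lattice d) lam (Λ n)) / (Λ n).card) atTop
      (𝓝 (-(1 / 2) * Real.log (ν.real {σ | σ (pastEvenOrigin d) = false}) +
        (1 / 2) * Real.log (1 + lam))) := by
  classical
  have hswap := odd_sum_single_add_iff (⟨0, hd⟩ : Fin d)
  have hodd := h.isFolner.tendsto_density_of_swap (fun v => Odd (∑ j, v j)) hswap
  have heven := h.isFolner.tendsto_density_of_swap (fun v => ¬ Odd (∑ j, v j))
    fun v => (hswap v).not
  have hlim := (h.isFolner.tendsto_average_log_vacancyRatio lattice_adj_add_right hlam hmix hν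
    (o := pastEvenOrigin d) rfl heven).add (hodd.mul_const (Real.log (1 + lam)))
  rw [mul_neg, ← neg_mul] at hlim
  refine hlim.congr fun n => ?_
  rw [log_partitionFunction_eq_sum_pastEven hlam, add_comm, add_div, mul_div_right_comm]

end Lattice

end HardCore

end

theorem corollary2_general (d : ℕ) (hd : 1 ≤ d) (lam : ℝ) (hlam : 0 ≤ lam)
    (hpast : HardCore.SpatialMixing ((HardCore.lattice d).induce (HardCore.past d)) lam)
    (hpastEven : HardCore.SpatialMixing ((HardCore.lattice d).induce (HardCore.pastEven d)) lam) :
    ∃ (μ : Measure (HardCore.past d → Bool)) (ν : Measure (HardCore.pastEven d → Bool)) (P : ℝ),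
      HardCore.IsUniqueGibbs ((HardCore.lattice d).induce (HardCore.past d)) lam μ ∧
      HardCore.IsUniqueGibbs ((HardCore.lattice d).induce (HardCore.pastEven d)) lam ν ∧
      HardCore.IsFreeEnergy d lam P ∧
      P = -Real.log (μ.real {σ | σ (HardCore.pastOrigin d) = false}) ∧
      P = -(1 / 2) * Real.log (ν.real {σ | σ (HardCore.pastEvenOrigin d) = false}) +
        (1 / 2) * Real.log (1 + lam) := by
  have hfinite (S : Set (Fin d → ℤ)) (v : S) :
      (((HardCore.lattice d).induce S).neighborSet v).Finite :=
    (HardCore.finite_neighborSet_lattice (v : Fin d → ℤ)).preimage Subtype.val_injective.injOn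
  obtain ⟨μ, hμ⟩ := HardCore.exists_isGibbs (hfinite (HardCore.past d)) hlam
  obtain ⟨ν, hν⟩ := HardCore.exists_isGibbs (hfinite (HardCore.pastEven d)) hlam
  have hbox := HardCore.isVanHove_box d
  exact ⟨μ, ν, _, hpast.isUniqueGibbs hlam hμ, hpastEven.isUniqueGibbs hlam hν,
    fun _ hΛ => hΛ.tendsto_past hlam hpast hμ, rfl,
    tendsto_nhds_unique (hbox.tendsto_past hlam hpast hμ)
      (hbox.tendsto_pastEven hd hlam hpastEven hν)⟩

theorem corollary2 (d : ℕ) (hd : 1 ≤ d) (lam : ℝ) (hlam : 0 < lam)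
    (hSSM : HardCore.StrongSpatialMixing (HardCore.lattice d) lam) :
    ∃ (μ : Measure (HardCore.past d → Bool)) (ν : Measure (HardCore.pastEven d → Bool)) (P : ℝ),
      HardCore.IsUniqueGibbs ((HardCore.lattice d).induce (HardCore.past d)) lam μ ∧
      HardCore.IsUniqueGibbs ((HardCore.lattice d).induce (HardCore.pastEven d)) lam ν ∧
      HardCore.IsFreeEnergy d lam P ∧
      P = -Real.log (μ.real {σ | σ (HardCore.pastOrigin d) = false}) ∧
      P = -(1 / 2) * Real.log (ν.real {σ | σ (HardCore.pastEvenOrigin d) = false}) +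
        (1 / 2) * Real.log (1 + lam) :=
  corollary2_general d hd lam hlam.le
    (hSSM.spatialMixing_of_embedding HardCore.finite_neighborSet_lattice (.induce _))
    (hSSM.spatialMixing_of_embedding HardCore.finite_neighborSet_lattice (.induce _))
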